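/- Let $n\in\{2,3\}$ and let $\Omega\subset\mathbb R^n$ be a bounded domain (nonempty, open, connected) whose boundary is piecewise $C^1$: apart from a set of boundary points of finite $(n-2)$-dimensional Hausdorff measure (finitely many corners if $n=2$; corners and edges of finite total length if $n=3$), $\partial\Omega$ is locally a $C^1$ hypersurface with $\Omega$ on exactly one side. For $i=1,2$ let $a_i:\mathbb R\to\mathbb R$ be continuous and $c_i\in L^\infty(\Omega)$ such that, for some constant $\alpha_i>0$, $\alpha_i\le a_i(u)\le 1/\alpha_i$ for all $u\in\mathbb R$ and $0\le c_i(x)\le 1/\alpha_i$ for a.e. $x\in\Omega$. Let $H^{1/2}(\partial\Omega)=H^1(\Omega)/H^1_0(\Omega)$ be the space of traces of functions in $H^1(\Omega)$, with norm $\|g\|_{H^{1/2}(\partial\Omega)}=\inf\{\|u\|_{H^1(\Omega)}: u|_{\partial\Omega}=g\}$, and let $H^{-1/2}(\partial\Omega)$ be its topological dual. Let $\Lambda^*_{a_i(0),c_i}:H^{1/2}(\partial\Omega)\to H^{-1/2}(\partial\Omega)$ be the Dirichlet-to-Neumann map $g^*\mapsto a_i(0)\partial_n v$, where $v\in H^1(\Omega)$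 is the weak solution of $$-a_i(0)\Delta v+c_i v=0\ \text{ in }\Omega,\qquad v=g^*\ \text{ on }\partial\Omega,$$ and the co-normal derivative $a_i(0)\partial_n v$ is defined by $\langle a_i(0)\partial_n v,\,w|_{\partial\Omega}\rangle=\int_\Omega a_i(0)\nabla v\cdot\nabla w+c_i v w\,dx$ for all $w\in H^1(\Omega)$. If $\Lambda^*_{a_1(0),c_1}=\Lambda^*_{a_2(0),c_2}$, then $a_1(0)=a_2(0)$. -/

import Mathlib

open MeasureTheory Set
open scoped ContDiff

noncomputable section

namespace LinDtN

/-- Euclidean space of dimension `n`. -/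
abbrev E (n : ℕ) := EuclideanSpace ℝ (Fin n)

/-! ### Domains with piecewise smooth boundary -/

/-- `x` is a `C¹` boundary point of `Ω`: near `x` the set `Ω` is the sublevel set `{f < 0}` of a
`C¹` function with nonvanishing derivative.  By the implicit function theorem the boundary is, near
`x`, the graph of a `C¹` function and `Ω` lies on exactly one side of it. -/
def IsC1BoundaryPoint {n : ℕ} (Ω : Set (E n)) (x : E n) : Prop :=
  x ∈ frontier Ω ∧ ∃ U : Set (E n), IsOpen U ∧ x ∈ U ∧ ∃ f : E n → ℝ,
    ContDiffOn ℝ 1 f U ∧ fderiv ℝ f x ≠ 0 ∧ Ω ∩ U = {y ∈ U | f y < 0}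

/-- A bounded domain (nonempty connected open set) whose boundary is piecewise `C¹`: all boundary
points are `C¹` boundary points, except those of a set of finite `(n-2)`-dimensional Hausdorff
measure (finitely many corners if `n = 2`, corners and edges of finite total length if `n = 3`). -/
structure IsPiecewiseC1Domain {n : ℕ} (Ω : Set (E n)) : Prop where
  isOpen : IsOpen Ω
  isConnected : IsConnected Ω
  isBounded : Bornology.IsBounded Ω
  singular_finite :
    μH[(n : ℝ) - 2] {x ∈ frontier Ω | ¬ IsC1BoundaryPoint Ω x} < ⊤

/-- The standing assumption on the coefficients: `a` is continuous on `ℝ`, `c` is (a.e.) measurable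
on `Ω`, and `α ≤ a ≤ 1/α` on `ℝ`, `0 ≤ c ≤ 1/α` a.e. in `Ω`, for some constant `α > 0`. -/
structure Admissible {n : ℕ} (Ω : Set (E n)) (a : ℝ → ℝ) (c : E n → ℝ) : Prop where
  continuous : Continuous a
  aemeasurable : AEMeasurable c (volume.restrict Ω)
  bounds : ∃ α : ℝ, 0 < α ∧ (∀ u, α ≤ a u ∧ a u ≤ 1 / α) ∧
    ∀ᵐ x ∂(volume.restrict Ω), 0 ≤ c x ∧ c x ≤ 1 / α

/-! ### The Sobolev spaces -/

/-- Test functions: `C^∞` functions with compact support contained in `Ω`. -/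
structure IsTest {n : ℕ} (Ω : Set (E n)) (φ : E n → ℝ) : Prop where
  smooth : ContDiff ℝ ∞ φ
  hasCompactSupport : HasCompactSupport φ
  tsupport_subset : tsupport φ ⊆ Ω

/-- Real-valued `L²(Ω)`. -/
abbrev L2 {n : ℕ} (Ω : Set (E n)) := Lp ℝ 2 (volume.restrict Ω)

/-- `L²(Ω)` vector fields. -/
abbrev L2Vec {n : ℕ} (Ω : Set (E n)) := Lp (E n) 2 (volume.restrict Ω)

/-- `G` is the weak gradient of `u` in `Ω`. -/
def IsWeakGrad {n : ℕ} (Ω : Set (E n)) (u : E n → ℝ) (G : E n → E n) : Prop :=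
  ∀ φ : E n → ℝ, IsTest Ω φ → ∀ e : E n,
    ∫ x in Ω, u x * fderiv ℝ φ x e = - ∫ x in Ω, inner ℝ (G x) e * φ x

lemma IsTest.memLp {n : ℕ} {Ω : Set (E n)} {φ : E n → ℝ} (h : IsTest Ω φ) :
    MemLp φ 2 (volume.restrict Ω) :=
  (h.smooth.continuous.memLp_of_hasCompactSupport h.hasCompactSupport).restrict _

lemma IsTest.memLp_fderiv {n : ℕ} {Ω : Set (E n)} {φ : E n → ℝ} (h : IsTest Ω φ) (e : E n) :
    MemLp (fun x => fderiv ℝ φ x e) 2 (volume.restrict Ω) :=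
  (((h.smooth.continuous_fderiv (by simp)).clm_apply
    continuous_const).memLp_of_hasCompactSupport
      (h.hasCompactSupport.fderiv_apply (𝕜 := ℝ) e)).restrict _

lemma IsTest.integrable_mul_fderiv {n : ℕ} {Ω : Set (E n)} {φ : E n → ℝ} (h : IsTest Ω φ)
    (e : E n) (u : L2 Ω) :
    Integrable (fun x => u x * fderiv ℝ φ x e) (volume.restrict Ω) :=
  (Lp.memLp u).integrable_mul (h.memLp_fderiv e)

lemma IsTest.integrable_inner_mul {n : ℕ} {Ω : Set (E n)} {φ : E n → ℝ} (h : IsTest Ω φ)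
    (e : E n) (G : L2Vec Ω) :
    Integrable (fun x => inner ℝ (G x) e * φ x) (volume.restrict Ω) :=
  ((Lp.memLp G).inner_const e).integrable_mul h.memLp

/-- The Sobolev space `H¹(Ω)`: all `u ∈ L²(Ω)` with a weak gradient in `L²(Ω)`.  An element is the
pair `(u, ∇u)` (the weak gradient being determined by `u` when `Ω` is open), and the norm, inherited
from the Hilbert sum `L²(Ω) ⊕ L²(Ω)ⁿ`, is `(‖u‖² + ‖∇u‖²)^{1/2}`. -/
def H1 {n : ℕ} (Ω : Set (E n)) : Submodule ℝ (WithLp 2 (L2 Ω × L2Vec Ω)) where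
  carrier := {p | IsWeakGrad Ω p.fst p.snd}
  zero_mem' := by
    intro φ _ e
    have h1 : ∀ᵐ x ∂(volume.restrict Ω), (0 : L2 Ω) x * fderiv ℝ φ x e = 0 := by
      filter_upwards [Lp.coeFn_zero ℝ 2 (volume.restrict Ω)] with x hx
      simp only [ZeroMemClass.coe_zero] at hx ⊢
      rw [hx]; simp
    have h2 : ∀ᵐ x ∂(volume.restrict Ω), inner ℝ ((0 : L2Vec Ω) x) e * φ x = 0 := by
      filter_upwards [Lp.coeFn_zero (E n) 2 (volume.restrict Ω)] with x hx
      simp only [ZeroMemClass.coe_zero] at hx ⊢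
      rw [hx]; simp
    have h1' := integral_congr_ae h1
    have h2' := integral_congr_ae h2
    simp only [integral_zero] at h1' h2'
    simp only [WithLp.zero_fst, WithLp.zero_snd]
    rw [h1', h2', neg_zero]
  add_mem' := by
    intro p q hp hq φ hφ e
    have h1 : ∀ᵐ x ∂(volume.restrict Ω), (p.fst + q.fst : L2 Ω) x * fderiv ℝ φ x e
        = p.fst x * fderiv ℝ φ x e + q.fst x * fderiv ℝ φ x e := by
      filter_upwards [Lp.coeFn_add p.fst q.fst] with x hx
      rw [hx, Pi.add_apply, add_mul]
    have h2 : ∀ᵐ x ∂(volume.restrict Ω), inner ℝ ((p.snd + q.snd : L2Vec Ω) x) e * φ x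
        = inner ℝ (p.snd x) e * φ x + inner ℝ (q.snd x) e * φ x := by
      filter_upwards [Lp.coeFn_add p.snd q.snd] with x hx
      rw [hx, Pi.add_apply, inner_add_left, add_mul]
    simp only [WithLp.add_fst, WithLp.add_snd]
    rw [integral_congr_ae h1, integral_congr_ae h2,
      integral_add (hφ.integrable_mul_fderiv e _) (hφ.integrable_mul_fderiv e _),
      integral_add (hφ.integrable_inner_mul e _) (hφ.integrable_inner_mul e _),
      hp φ hφ e, hq φ hφ e, neg_add]
  smul_mem' := by
    intro t p hp φ hφ e
    have h1 : ∀ᵐ x ∂(volume.restrict Ω), (t • p.fst : L2 Ω) x * fderiv ℝ φ x e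
        = t * (p.fst x * fderiv ℝ φ x e) := by
      filter_upwards [Lp.coeFn_smul t p.fst] with x hx
      rw [hx, Pi.smul_apply, smul_eq_mul, mul_assoc]
    have h2 : ∀ᵐ x ∂(volume.restrict Ω), inner ℝ ((t • p.snd : L2Vec Ω) x) e * φ x
        = t * (inner ℝ (p.snd x) e * φ x) := by
      filter_upwards [Lp.coeFn_smul t p.snd] with x hx
      rw [hx, Pi.smul_apply, real_inner_smul_left, mul_assoc]
    simp only [WithLp.smul_fst, WithLp.smul_snd]
    rw [integral_congr_ae h1, integral_congr_ae h2, integral_const_mul, integral_const_mul,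
      hp φ hφ e, mul_neg]

/-- The function underlying an element of `H¹(Ω)`. -/
def fn {n : ℕ} {Ω : Set (E n)} (u : H1 Ω) : E n → ℝ := u.1.fst

/-- The weak gradient of an element of `H¹(Ω)`. -/
def grad {n : ℕ} {Ω : Set (E n)} (u : H1 Ω) : E n → E n := u.1.snd

/-- `H¹₀(Ω)`: the closure of the test functions in `H¹(Ω)`. -/
def H10 {n : ℕ} (Ω : Set (E n)) : Submodule ℝ (H1 Ω) :=
  (Submodule.span ℝ {u : H1 Ω | ∃ φ, IsTest Ω φ ∧
    fn u =ᵐ[volume.restrict Ω] φ ∧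
    grad u =ᵐ[volume.restrict Ω] gradient φ}).topologicalClosure

instance H10.isClosed {n : ℕ} (Ω : Set (E n)) : IsClosed (H10 Ω : Set (H1 Ω)) :=
  Submodule.isClosed_topologicalClosure (Submodule.span ℝ _)

/-- The trace space `H^{1/2}(∂Ω)` of `H¹(Ω)`: two functions of `H¹(Ω)` have the same trace iff their
difference lies in `H¹₀(Ω)`.  The quotient norm is
`‖g‖ = inf {‖u‖_{H¹(Ω)} : u ∈ H¹(Ω), u|_∂Ω = g}`. -/
abbrev HHalf {n : ℕ} (Ω : Set (E n)) := H1 Ω ⧸ H10 Ω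

/-- The trace map `u ↦ u|_∂Ω`, from `H¹(Ω)` onto `H^{1/2}(∂Ω)`. -/
def trace {n : ℕ} {Ω : Set (E n)} (u : H1 Ω) : HHalf Ω := (H10 Ω).mkQ u

/-- The topological dual `H^{-1/2}(∂Ω)` of `H^{1/2}(∂Ω)`. -/
abbrev HNegHalf {n : ℕ} (Ω : Set (E n)) := StrongDual ℝ (HHalf Ω)

/-! ### The linear boundary value problem and its Dirichlet-to-Neumann map -/

/-- The form `∫_Ω k ∇v · ∇w + c v w dx`, with a constant `k` and a function `c`. -/
def form {n : ℕ} (Ω : Set (E n)) (k : ℝ) (c : E n → ℝ) (v w : H1 Ω) : ℝ :=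
  ∫ x in Ω, (k * inner ℝ (grad v x) (grad w x) + c x * fn v x * fn w x)

/-- `v ∈ H¹(Ω)` is a weak solution of `-k Δv + c v = 0` in `Ω`, `v = g` on `∂Ω`. -/
def IsWeakSolution {n : ℕ} (Ω : Set (E n)) (k : ℝ) (c : E n → ℝ) (g : HHalf Ω) (v : H1 Ω) :
    Prop :=
  trace v = g ∧ ∀ w ∈ H10 Ω, form Ω k c v w = 0

/-- `ψ ∈ H^{-1/2}(∂Ω)` is the generalized co-normal derivative `k ∂ₙv` of `v`:
`⟨ψ, w|_∂Ω⟩ = ∫_Ω k ∇v · ∇w + c v w dx` for all `w ∈ H¹(Ω)`. -/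
def IsConormal {n : ℕ} (Ω : Set (E n)) (k : ℝ) (c : E n → ℝ) (v : H1 Ω) (ψ : HNegHalf Ω) : Prop :=
  ∀ w : H1 Ω, ψ (trace w) = form Ω k c v w

/-- The Dirichlet-to-Neumann map `H^{1/2}(∂Ω) → H^{-1/2}(∂Ω)`, `g ↦ k ∂ₙv`, of `-k Δv + c v = 0`,
given by its graph: the pairs `(g, k ∂ₙv)` where `v` is the weak solution with boundary value `g`. -/
def dtn {n : ℕ} (Ω : Set (E n)) (k : ℝ) (c : E n → ℝ) : Set (HHalf Ω × HNegHalf Ω) :=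
  {p | ∃ v : H1 Ω, IsWeakSolution Ω k c p.1 v ∧ IsConormal Ω k c v p.2}

end LinDtN

end

/-!
Write `kᵢ = aᵢ(0)` and let `v₁`, `v₂` be the solutions of the two linear problems with the same
boundary values as a given `u ∈ H¹(Ω)`. Testing the co-normal derivatives with `u|_∂Ω`, equality of
the Dirichlet-to-Neumann maps gives equality of the two energies, `form₁(v₁, v₁) = form₂(v₂, v₂)`.
Dirichlet's principle bounds the left side above by `form₁(u, u) ≤ k₁ ‖∇u‖² + M ‖u‖²`, and since
`c₂ ≥ 0` the right side is at least `k₂ ‖∇v₂‖²`. If `u` is harmonic it has the least Dirichlet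
integral for its boundary values, so that `k₂ ‖∇v₂‖² ≥ k₂ ‖∇u‖²`, and altogether
`(k₂ - k₁) ‖∇u‖² ≤ M ‖u‖²` (`sub_mul_norm_gradL_sq_le`).

The harmonic functions `u = e^{s x₀} cos (s x₁)` satisfy `|∇u|² = s² e^{2 s x₀} ≥ s² u²` pointwise
(`mul_norm_fnL_le`), so for large `s` the estimate is only possible if `k₂ ≤ k₁` (`le_of_dtn_eq`).
By symmetry `k₁ = k₂`.

As these `u` are entire, no property of the boundary enters; `Ω` only has to be open, bounded and
nonempty, in dimension at least two. Existence of `v₂` is Lax–Milgram together with the Poincaré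
inequality on `H¹₀(Ω)` (`exists_isWeakSolution`, `norm_fnL_le_of_mem_H10`), and the minimality of
harmonic functions is their orthogonality to `H¹₀(Ω)` in the Dirichlet inner product
(`inner_gradL_eq_zero`).
-/

noncomputable section

namespace LinDtN

variable {n : ℕ} {Ω : Set (E n)}

/-! ### The Hilbert space `H¹(Ω)` and the bilinear form -/

/-- The projection `u ↦ u` from `H¹(Ω)` to `L²(Ω)`. -/
def fnL (Ω : Set (E n)) : H1 Ω →L[ℝ] L2 Ω := (WithLp.fstL 2 ℝ _ _).comp (H1 Ω).subtypeL

/-- The projection `u ↦ ∇u` from `H¹(Ω)` to the `L²` vector fields. -/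
def gradL (Ω : Set (E n)) : H1 Ω →L[ℝ] L2Vec Ω := (WithLp.sndL 2 ℝ _ _).comp (H1 Ω).subtypeL

lemma coeFn_fnL (u : H1 Ω) : ⇑(fnL Ω u) = fn u := rfl

lemma coeFn_gradL (u : H1 Ω) : ⇑(gradL Ω u) = grad u := rfl

lemma norm_sq_eq (u : H1 Ω) : ‖u‖ ^ 2 = ‖fnL Ω u‖ ^ 2 + ‖gradL Ω u‖ ^ 2 :=
  WithLp.prod_norm_sq_eq_of_L2 u.1

lemma inner_toLp_left {F : Type*} [NormedAddCommGroup F] [InnerProductSpace ℝ F]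
    {μ : Measure (E n)} {f : E n → F} (hf : MemLp f 2 μ) (g : Lp F 2 μ) :
    inner ℝ (hf.toLp f) g = ∫ x, inner ℝ (f x) (g x) ∂μ := by
  rw [L2.inner_def]
  refine integral_congr_ae ?_
  filter_upwards [hf.coeFn_toLp] with x hx
  rw [hx]

lemma IsTest.memLp_smul {φ : E n → ℝ} (h : IsTest Ω φ) (e : E n) :
    MemLp (fun x => φ x • e) 2 (volume.restrict Ω) :=
  ((h.smooth.continuous.smul continuous_const).memLp_of_hasCompactSupport
    h.hasCompactSupport.smul_right).restrict _

lemma isClosed_H1 (Ω : Set (E n)) : IsClosed (H1 Ω : Set (WithLp 2 (L2 Ω × L2Vec Ω))) := by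
  have key : (H1 Ω : Set (WithLp 2 (L2 Ω × L2Vec Ω))) =
      ⋂ (φ : E n → ℝ) (h : IsTest Ω φ) (e : E n),
        {p | inner ℝ ((h.memLp_fderiv e).toLp _) p.fst
          = - inner ℝ ((h.memLp_smul e).toLp _) p.snd} := by
    ext p
    simp only [mem_iInter, mem_ofPred_eq, inner_toLp_left]
    refine forall_congr' fun φ => forall_congr' fun h => forall_congr' fun e => ?_
    simp [real_inner_smul_left, real_inner_comm e, mul_comm (φ _)]
  rw [key]
  refine isClosed_iInter fun φ => isClosed_iInter fun h => isClosed_iInter fun e => ?_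
  exact isClosed_eq
    (continuous_const.inner (WithLp.fstL 2 ℝ (L2 Ω) (L2Vec Ω)).continuous)
    (continuous_const.inner (WithLp.sndL 2 ℝ (L2 Ω) (L2Vec Ω)).continuous).neg

instance : CompleteSpace (H1 Ω) := (isClosed_H1 Ω).completeSpace_coe

/-- Multiplication by a bounded measurable function, as an operator on `L²(Ω)`. -/
lemma exists_mulL {c : E n → ℝ} {M : ℝ} (hc : AEMeasurable c (volume.restrict Ω))
    (hM : ∀ᵐ x ∂(volume.restrict Ω), 0 ≤ c x ∧ c x ≤ M) :
    ∃ T : L2 Ω →L[ℝ] L2 Ω, ∀ u, T u =ᵐ[volume.restrict Ω] fun x => c x * u x := by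
  have hb (u : L2 Ω) : ∀ᵐ x ∂(volume.restrict Ω), ‖c x * u x‖ ≤ M * ‖u x‖ := by
    filter_upwards [hM] with x hx
    rw [norm_mul, Real.norm_of_nonneg hx.1]
    exact mul_le_mul_of_nonneg_right hx.2 (norm_nonneg _)
  have hm (u : L2 Ω) : MemLp (fun x => c x * u x) 2 (volume.restrict Ω) :=
    (Lp.memLp u).of_le_mul (hc.aestronglyMeasurable.mul (Lp.aestronglyMeasurable u)) (hb u)
  refine ⟨LinearMap.mkContinuous
    { toFun := fun u => (hm u).toLp _
      map_add' := fun u v => ?_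
      map_smul' := fun t u => ?_ } M fun u => ?_, fun u => (hm u).coeFn_toLp⟩
  · refine Lp.ext ?_
    filter_upwards [(hm (u + v)).coeFn_toLp, (hm u).coeFn_toLp, (hm v).coeFn_toLp,
      Lp.coeFn_add u v, Lp.coeFn_add ((hm u).toLp _) ((hm v).toLp _)] with x h1 h2 h3 h4 h5
    rw [h1, h5, Pi.add_apply, h2, h3, h4, Pi.add_apply, mul_add]
  · refine Lp.ext ?_
    filter_upwards [(hm (t • u)).coeFn_toLp, (hm u).coeFn_toLp,
      Lp.coeFn_smul t u, Lp.coeFn_smul t ((hm u).toLp _)] with x h1 h2 h3 h4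
    rw [h1, RingHom.id_apply, h4, Pi.smul_apply, h2, h3, Pi.smul_apply, smul_eq_mul, smul_eq_mul]
    ring
  · refine Lp.norm_le_mul_norm_of_ae_le_mul ?_
    filter_upwards [(hm u).coeFn_toLp, hb u] with x h1 h2
    change ‖(hm u).toLp _ x‖ ≤ _
    rw [h1]
    exact h2

lemma inner_mulL_self_nonneg {c : E n → ℝ} {M : ℝ} {u v : L2 Ω}
    (hM : ∀ᵐ x ∂(volume.restrict Ω), 0 ≤ c x ∧ c x ≤ M)
    (hv : v =ᵐ[volume.restrict Ω] fun x => c x * u x) : 0 ≤ inner ℝ v u := by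
  rw [L2.inner_def]
  refine integral_nonneg_of_ae ?_
  filter_upwards [hv, hM] with x h1 h2
  rw [h1]
  simp only [Pi.zero_apply, RCLike.inner_apply, conj_trivial]
  nlinarith [mul_nonneg h2.1 (mul_self_nonneg (u x))]

lemma inner_mulL_self_le {c : E n → ℝ} {M : ℝ} {u v : L2 Ω}
    (hM : ∀ᵐ x ∂(volume.restrict Ω), 0 ≤ c x ∧ c x ≤ M)
    (hv : v =ᵐ[volume.restrict Ω] fun x => c x * u x) : inner ℝ v u ≤ M * ‖u‖ ^ 2 := by
  rw [← real_inner_self_eq_norm_sq, L2.inner_def, L2.inner_def, ← integral_const_mul]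
  refine integral_mono_ae (L2.integrable_inner _ _) ((L2.integrable_inner _ _).const_mul M) ?_
  filter_upwards [hv, hM] with x h1 h2
  rw [h1]
  simp only [RCLike.inner_apply, conj_trivial]
  nlinarith [mul_le_mul_of_nonneg_right h2.2 (mul_self_nonneg (u x))]

lemma integral_form_eq (k : ℝ) {c : E n → ℝ} (G H : L2Vec Ω) {u v w : L2 Ω}
    (hv : v =ᵐ[volume.restrict Ω] fun x => c x * u x) :
    ∫ x in Ω, (k * inner ℝ (G x) (H x) + c x * u x * w x)
      = k * inner ℝ G H + inner ℝ v w := by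
  rw [L2.inner_def, L2.inner_def, ← integral_const_mul,
    ← integral_add ((L2.integrable_inner _ _).const_mul k) (L2.integrable_inner _ _)]
  refine integral_congr_ae ?_
  filter_upwards [hv] with x hx
  rw [hx, real_inner_comm (w x)]
  simp only [RCLike.inner_apply, conj_trivial]

lemma form_eq {k : ℝ} {c : E n → ℝ} {T : L2 Ω →L[ℝ] L2 Ω}
    (hT : ∀ u, T u =ᵐ[volume.restrict Ω] fun x => c x * u x) (v w : H1 Ω) :
    form Ω k c v w =
      k * inner ℝ (gradL Ω v) (gradL Ω w) + inner ℝ (T (fnL Ω v)) (fnL Ω w) :=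
  integral_form_eq k (gradL Ω v) (gradL Ω w) (hT _)

/-- For fixed `v`, the form `∫ k ∇v · ∇w + c v w` is a bounded linear functional of `w`. -/
lemma exists_formL (k : ℝ) {c : E n → ℝ} {M : ℝ} (hc : AEMeasurable c (volume.restrict Ω))
    (hM : ∀ᵐ x ∂(volume.restrict Ω), 0 ≤ c x ∧ c x ≤ M) (v : H1 Ω) :
    ∃ B : H1 Ω →L[ℝ] ℝ, ∀ w, B w = form Ω k c v w := by
  obtain ⟨T, hT⟩ := exists_mulL hc hM
  refine ⟨k • (innerSL ℝ (gradL Ω v)).comp (gradL Ω) +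
    (innerSL ℝ (T (fnL Ω v))).comp (fnL Ω), fun w => ?_⟩
  exact (form_eq hT v w).symm

lemma form_comm (k : ℝ) (c : E n → ℝ) (v w : H1 Ω) : form Ω k c v w = form Ω k c w v := by
  simp only [form, real_inner_comm]
  congr 1; ext x; ring

lemma form_add_right (k : ℝ) {c : E n → ℝ} {M : ℝ} (hc : AEMeasurable c (volume.restrict Ω))
    (hM : ∀ᵐ x ∂(volume.restrict Ω), 0 ≤ c x ∧ c x ≤ M) (v w z : H1 Ω) :
    form Ω k c v (w + z) = form Ω k c v w + form Ω k c v z := by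
  obtain ⟨B, hB⟩ := exists_formL k hc hM v
  rw [← hB, ← hB, ← hB, map_add]

lemma form_add_left (k : ℝ) {c : E n → ℝ} {M : ℝ} (hc : AEMeasurable c (volume.restrict Ω))
    (hM : ∀ᵐ x ∂(volume.restrict Ω), 0 ≤ c x ∧ c x ≤ M) (v w z : H1 Ω) :
    form Ω k c (v + w) z = form Ω k c v z + form Ω k c w z := by
  rw [form_comm k c (v + w), form_add_right k hc hM, form_comm k c z v, form_comm k c z w]

/-- The quadratic form is bounded below by its principal part, since the potential is
nonnegative. -/
lemma le_form_self (k : ℝ) {c : E n → ℝ} {M : ℝ} (hc : AEMeasurable c (volume.restrict Ω))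
    (hM : ∀ᵐ x ∂(volume.restrict Ω), 0 ≤ c x ∧ c x ≤ M) (v : H1 Ω) :
    k * ‖gradL Ω v‖ ^ 2 ≤ form Ω k c v v := by
  obtain ⟨T, hT⟩ := exists_mulL hc hM
  rw [form_eq hT v v, real_inner_self_eq_norm_sq (gradL Ω v)]
  exact le_add_of_nonneg_right (inner_mulL_self_nonneg hM (hT _))

lemma form_self_le (k : ℝ) {c : E n → ℝ} {M : ℝ} (hc : AEMeasurable c (volume.restrict Ω))
    (hM : ∀ᵐ x ∂(volume.restrict Ω), 0 ≤ c x ∧ c x ≤ M) (v : H1 Ω) :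
    form Ω k c v v ≤ k * ‖gradL Ω v‖ ^ 2 + M * ‖fnL Ω v‖ ^ 2 := by
  obtain ⟨T, hT⟩ := exists_mulL hc hM
  exact (form_eq hT v v).trans_le
    (add_le_add (congrArg (k * ·) (real_inner_self_eq_norm_sq (gradL Ω v))).le
      (inner_mulL_self_le hM (hT _)))

/-! ### Solvability of the Dirichlet problem -/

/-- Lax–Milgram on a closed subspace `K`, for a form `k ⟪g v, g w⟫ + ⟪T (f v), f w⟫` whose second
part is nonnegative and whose first part is coercive on `K`. -/
lemma exists_mem_forall_form_eq {H F G : Type*} [NormedAddCommGroup H] [InnerProductSpace ℝ H]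
    [CompleteSpace H] [NormedAddCommGroup F] [InnerProductSpace ℝ F] [NormedAddCommGroup G]
    [InnerProductSpace ℝ G] {K : Submodule ℝ H} (hK : IsClosed (K : Set H)) (k : ℝ)
    (f : H →L[ℝ] F) (g : H →L[ℝ] G) (T : F →L[ℝ] F) (hT : ∀ y, 0 ≤ inner ℝ (T y) y)
    {κ : ℝ} (hκ : 0 < κ) (hB : ∀ z ∈ K, κ * ‖z‖ ^ 2 ≤ k * ‖g z‖ ^ 2) (u : H) :
    ∃ z ∈ K, ∀ w ∈ K, k * inner ℝ (g z) (g w) + inner ℝ (T (f z)) (f w)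
      = k * inner ℝ (g u) (g w) + inner ℝ (T (f u)) (f w) := by
  have : CompleteSpace K := hK.completeSpace_coe
  let B : H →L[ℝ] H →L[ℝ] ℝ :=
    k • (innerSL ℝ).bilinearComp g g + (innerSL ℝ).bilinearComp (T ∘L f) f
  have hBv (v w : H) : B v w = k * inner ℝ (g v) (g w) + inner ℝ (T (f v)) (f w) := by simp [B]
  let B₀ : K →L[ℝ] K →L[ℝ] ℝ := B.bilinearComp K.subtypeL K.subtypeL
  have hco : IsCoercive B₀ := ⟨κ, hκ, fun z => by
    rw [mul_assoc, ← sq]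
    refine (hB z.1 z.2).trans ((le_add_of_nonneg_right (hT (f z))).trans_eq ?_)
    rw [← real_inner_self_eq_norm_sq]
    exact (hBv z z).symm⟩
  let ℓ : K →L[ℝ] ℝ := (B u).comp K.subtypeL
  let z : K := hco.continuousLinearEquivOfBilin.symm ((InnerProductSpace.toDual ℝ _).symm ℓ)
  refine ⟨z, z.2, fun w hw => ?_⟩
  have h := hco.continuousLinearEquivOfBilin_apply z ⟨w, hw⟩
  rw [ContinuousLinearEquiv.apply_symm_apply, InnerProductSpace.toDual_symm_apply] at h
  exact (hBv z w).symm.trans (h.symm.trans (hBv u w))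

lemma trace_sub_eq_of_mem {u z : H1 Ω} (hz : z ∈ H10 Ω) : trace (u - z) = trace u :=
  (Submodule.Quotient.eq _).2 (by rw [sub_sub_cancel_left]; exact (H10 Ω).neg_mem hz)

lemma div_mul_sq_add_sq_le {k C x y : ℝ} (hk : 0 < k) (hx : 0 ≤ x) (h : x ≤ C * y) :
    k / (C ^ 2 + 1) * (x ^ 2 + y ^ 2) ≤ k * y ^ 2 := by
  have h2 := pow_le_pow_left₀ hx h 2
  calc k / (C ^ 2 + 1) * (x ^ 2 + y ^ 2)
    _ ≤ k / (C ^ 2 + 1) * ((C * y) ^ 2 + y ^ 2) := by gcongr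
    _ = k * y ^ 2 := by field_simp

/-- If `H¹₀(Ω)` satisfies a Poincaré inequality, then every trace is the boundary value of a weak
solution. -/
lemma exists_isWeakSolution {k : ℝ} (hk : 0 < k) {c : E n → ℝ} {M : ℝ}
    (hc : AEMeasurable c (volume.restrict Ω))
    (hM : ∀ᵐ x ∂(volume.restrict Ω), 0 ≤ c x ∧ c x ≤ M) {C : ℝ}
    (hC : ∀ z ∈ H10 Ω, ‖fnL Ω z‖ ≤ C * ‖gradL Ω z‖) (u : H1 Ω) :
    ∃ v, IsWeakSolution Ω k c (trace u) v := by
  obtain ⟨T, hT⟩ := exists_mulL hc hM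
  have hco : ∀ z ∈ H10 Ω, k / (C ^ 2 + 1) * ‖z‖ ^ 2 ≤ k * ‖gradL Ω z‖ ^ 2 := fun z hz =>
    (congrArg (k / (C ^ 2 + 1) * ·) (norm_sq_eq z)).trans_le
      (div_mul_sq_add_sq_le hk (norm_nonneg _) (hC z hz))
  have hκ : 0 < k / (C ^ 2 + 1) := by positivity
  obtain ⟨z, hz, hzB⟩ := exists_mem_forall_form_eq (H10.isClosed Ω) k (fnL Ω) (gradL Ω) T
    (fun y => inner_mulL_self_nonneg hM (hT y)) hκ hco u
  refine ⟨u - z, trace_sub_eq_of_mem hz, fun w hw => ?_⟩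
  have h1 := form_add_left k hc hM (u - z) z w
  have h2 := (form_eq hT z w).trans ((hzB w hw).trans (form_eq hT u w).symm)
  rw [sub_add_cancel] at h1
  exact add_eq_right.1 (h1.symm.trans h2.symm)

/-- A weak solution has a co-normal derivative: the functional `w ↦ form v w` vanishes on
`H¹₀(Ω)` and hence descends to the trace space. -/
lemma IsWeakSolution.exists_isConormal {k : ℝ} {c : E n → ℝ} {M : ℝ}
    (hc : AEMeasurable c (volume.restrict Ω))
    (hM : ∀ᵐ x ∂(volume.restrict Ω), 0 ≤ c x ∧ c x ≤ M) {g : HHalf Ω} {v : H1 Ω}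
    (hv : IsWeakSolution Ω k c g v) : ∃ ψ, IsConormal Ω k c v ψ := by
  obtain ⟨B, hB⟩ := exists_formL k hc hM v
  refine ⟨(H10 Ω).liftQL B fun w hw => ?_, fun w => hB w⟩
  exact (hB w).trans (hv.2 w hw)

/-! ### The variational characterization of the Dirichlet-to-Neumann map -/

lemma IsWeakSolution.exists_eq_add {k : ℝ} {c : E n → ℝ} {u v : H1 Ω}
    (hv : IsWeakSolution Ω k c (trace u) v) : ∃ z ∈ H10 Ω, v = u + z :=
  ⟨v - u, (Submodule.Quotient.eq _).1 hv.1, by abel⟩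

lemma IsConormal.apply_trace_eq {k : ℝ} {c : E n → ℝ} {u v : H1 Ω} {ψ : HNegHalf Ω}
    (hv : IsWeakSolution Ω k c (trace u) v) (hψ : IsConormal Ω k c v ψ) :
    ψ (trace u) = form Ω k c v v := by
  rw [← hv.1, hψ v]

/-- Dirichlet's principle: the weak solution minimizes the quadratic form among all functions with
the same trace. -/
lemma IsWeakSolution.form_self_le {k : ℝ} (hk : 0 ≤ k) {c : E n → ℝ} {M : ℝ}
    (hc : AEMeasurable c (volume.restrict Ω))
    (hM : ∀ᵐ x ∂(volume.restrict Ω), 0 ≤ c x ∧ c x ≤ M) {u v : H1 Ω}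
    (hv : IsWeakSolution Ω k c (trace u) v) : form Ω k c v v ≤ form Ω k c u u := by
  obtain ⟨z, hz, rfl⟩ := hv.exists_eq_add
  have h1 : form Ω k c (u + z) z = 0 := hv.2 z hz
  have h2 := form_add_right k hc hM (u + z) u z
  have h3 := form_add_left k hc hM u z u
  have h4 := form_add_left k hc hM u z z
  have h5 : 0 ≤ form Ω k c z z :=
    (by positivity : 0 ≤ k * ‖gradL Ω z‖ ^ 2).trans (le_form_self k hc hM z)
  rw [form_comm k c z u] at h3
  linarith

/-! ### Test functions and the Poincaré inequality -/

/-- A closed condition on `H¹(Ω)` that holds for test functions holds on `H¹₀(Ω)`. The test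
functions form a subspace already, so taking their span adds nothing. -/
lemma H10_induction {P : H1 Ω → Prop} (hP : IsClosed {u | P u})
    (h : ∀ (u : H1 Ω) (φ : E n → ℝ), IsTest Ω φ → fn u =ᵐ[volume.restrict Ω] φ →
      grad u =ᵐ[volume.restrict Ω] gradient φ → P u) {u : H1 Ω} (hu : u ∈ H10 Ω) : P u := by
  suffices hs : ∀ v ∈ Submodule.span ℝ {u : H1 Ω | ∃ φ, IsTest Ω φ ∧
      fn u =ᵐ[volume.restrict Ω] φ ∧ grad u =ᵐ[volume.restrict Ω] gradient φ},
      ∃ φ, IsTest Ω φ ∧ fn v =ᵐ[volume.restrict Ω] φ ∧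
        grad v =ᵐ[volume.restrict Ω] gradient φ by
    refine closure_minimal (t := {u | P u}) (fun v hv => ?_) hP (show u ∈ closure _ from hu)
    obtain ⟨φ, h1, h2, h3⟩ := hs v hv
    exact h v φ h1 h2 h3
  intro v hv
  induction hv using Submodule.span_induction with
  | mem v hv => exact hv
  | zero =>
    refine ⟨fun _ => 0, ⟨contDiff_const, HasCompactSupport.zero, by simp [tsupport]⟩,
      Lp.coeFn_zero ℝ 2 _, ?_⟩
    refine (Lp.coeFn_zero (E n) 2 _).trans (Filter.Eventually.of_forall fun x => ?_)
    simp [gradient]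
  | add v w _ _ hv hw =>
    obtain ⟨φ, h1, h2, h3⟩ := hv
    obtain ⟨χ, k1, k2, k3⟩ := hw
    refine ⟨φ + χ, ⟨h1.smooth.add k1.smooth, h1.hasCompactSupport.add k1.hasCompactSupport,
      (tsupport_add φ χ).trans (union_subset h1.tsupport_subset k1.tsupport_subset)⟩, ?_, ?_⟩
    · exact (Lp.coeFn_add (fnL Ω v) (fnL Ω w)).trans (h2.add k2)
    · refine ((Lp.coeFn_add (gradL Ω v) (gradL Ω w)).trans (h3.add k3)).trans
        (Filter.Eventually.of_forall fun x => ?_)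
      simp [gradient, fderiv_add (h1.smooth.differentiable (by simp) x)
        (k1.smooth.differentiable (by simp) x)]
  | smul t v _ hv =>
    obtain ⟨φ, h1, h2, h3⟩ := hv
    refine ⟨t • φ, ⟨contDiff_const.smul h1.smooth, h1.hasCompactSupport.smul_left,
      (tsupport_smul_subset_right (fun _ => t) φ).trans h1.tsupport_subset⟩, ?_, ?_⟩
    · exact (Lp.coeFn_smul t (fnL Ω v)).trans (h2.const_smul t)
    · refine ((Lp.coeFn_smul t (gradL Ω v)).trans (h3.const_smul t)).trans
        (Filter.Eventually.of_forall fun x => ?_)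
      simp [gradient, fderiv_const_smul (h1.smooth.differentiable (by simp) x)]

lemma IsTest.mul_left {φ f : E n → ℝ} (hφ : IsTest Ω φ) (hf : ContDiff ℝ ∞ f) :
    IsTest Ω (fun x => f x * φ x) :=
  ⟨hf.mul hφ.smooth, hφ.hasCompactSupport.mul_left,
    (tsupport_mul_subset_right (f := f) (g := φ)).trans hφ.tsupport_subset⟩

lemma le_two_mul_of_sq_eq {x y R t w : ℝ} (hx : 0 ≤ x) (hy : 0 ≤ y) (hR : 0 ≤ R)
    (h1 : x ^ 2 = -2 * t) (h2 : |t| ≤ w * y) (h3 : w ≤ R * x) : x ≤ 2 * R * y := by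
  rcases hx.eq_or_lt with rfl | hx'
  · positivity
  · refine le_of_mul_le_mul_left ?_ hx'
    have h4 := neg_abs_le t
    have h5 := mul_le_mul_of_nonneg_right h3 hy
    linarith

/-- The Poincaré inequality for a test function `φ`. It comes from the identity
`∫ φ² = -2 ∫ xᵢ φ ∂ᵢφ`. -/
lemma IsTest.norm_le_norm_grad (i : Fin n) {R : ℝ} (hR0 : 0 ≤ R) (hR : ∀ x ∈ Ω, ‖x‖ ≤ R)
    (hΩ : IsOpen Ω) {φ : E n → ℝ} (hφ : IsTest Ω φ) {u : L2 Ω} {G : L2Vec Ω}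
    (hu : u =ᵐ[volume.restrict Ω] φ) (hG : G =ᵐ[volume.restrict Ω] gradient φ)
    (hw : IsWeakGrad Ω u G) : ‖u‖ ≤ 2 * R * ‖G‖ := by
  let p : E n →L[ℝ] ℝ := EuclideanSpace.proj i
  have hp : ContDiff ℝ ∞ p := p.contDiff
  let e : E n := EuclideanSpace.single i 1
  have hpe : p e = 1 := by simp [p, e]
  -- the vector field `xᵢ φ eᵢ`
  have hW : MemLp (fun x => (p x * φ x) • e) 2 (volume.restrict Ω) :=
    (hφ.mul_left hp).memLp_smul e
  have hWn : ‖hW.toLp‖ ≤ R * ‖u‖ := by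
    refine Lp.norm_le_mul_norm_of_ae_le_mul ?_
    filter_upwards [hW.coeFn_toLp, hu, ae_restrict_mem hΩ.measurableSet] with x h1 h2 h3
    have h4 : ‖p x‖ ≤ R := (PiLp.norm_apply_le x i).trans (hR x h3)
    have h5 : ‖e‖ = 1 := by simp [e]
    rw [h1, h2, norm_smul, norm_mul, h5, mul_one]
    gcongr
  have hl : ∫ x in Ω, u x * fderiv ℝ (fun x => p x * φ x) x e
      = ∫ x in Ω, (inner ℝ (u x) (u x) + inner ℝ (hW.toLp _ x) (G x)) := by
    refine integral_congr_ae ?_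
    filter_upwards [hu, hG, hW.coeFn_toLp] with x h3 h4 h5
    rw [h3, h4, h5, real_inner_smul_left, real_inner_comm _ e,
      inner_gradient_left, fderiv_fun_mul p.differentiableAt
        (hφ.smooth.differentiable (by simp) x)]
    simp [hpe]
    ring
  have hr : ∫ x in Ω, inner ℝ (G x) e * (p x * φ x)
      = ∫ x in Ω, inner ℝ (hW.toLp _ x) (G x) := by
    refine integral_congr_ae ?_
    filter_upwards [hW.coeFn_toLp] with x h5
    rw [h5, real_inner_smul_left, real_inner_comm, mul_comm]
  have hid : ∫ x in Ω, inner ℝ (u x) (u x) = -2 * ∫ x in Ω, inner ℝ (hW.toLp _ x) (G x) := by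
    have h := hw _ (hφ.mul_left hp) e
    rw [hl, hr, integral_add (L2.integrable_inner _ _) (L2.integrable_inner _ _)] at h
    linarith
  rw [← L2.inner_def (𝕜 := ℝ) u u, ← L2.inner_def (𝕜 := ℝ) hW.toLp G] at hid
  exact le_two_mul_of_sq_eq (norm_nonneg _) (norm_nonneg _) hR0
    ((real_inner_self_eq_norm_sq u).symm.trans hid) (abs_real_inner_le_norm _ _) hWn

/-- The Poincaré inequality on `H¹₀(Ω)`, for bounded `Ω` in positive dimension. -/
lemma norm_fnL_le_of_mem_H10 (i : Fin n) {R : ℝ} (hR0 : 0 ≤ R) (hR : ∀ x ∈ Ω, ‖x‖ ≤ R)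
    (hΩ : IsOpen Ω) {u : H1 Ω} (hu : u ∈ H10 Ω) : ‖fnL Ω u‖ ≤ 2 * R * ‖gradL Ω u‖ :=
  H10_induction (P := fun u => ‖fnL Ω u‖ ≤ 2 * R * ‖gradL Ω u‖)
    (isClosed_le (fnL Ω).continuous.norm (continuous_const.mul (gradL Ω).continuous.norm))
    (fun u _ hφ hfn hgrad => hφ.norm_le_norm_grad i hR0 hR hΩ hfn hgrad u.2) hu

/-! ### Harmonic functions -/

/-- Integration by parts against a test function. -/
lemma IsTest.integral_mul_fderiv {φ f : E n → ℝ} (hφ : IsTest Ω φ) (hf : ContDiff ℝ 1 f) (e : E n) :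
    ∫ x in Ω, f x * fderiv ℝ φ x e = - ∫ x in Ω, fderiv ℝ f x e * φ x := by
  have hφ' : Continuous fun x => fderiv ℝ φ x e :=
    (hφ.smooth.continuous_fderiv (by simp)).clm_apply continuous_const
  have hf' : Continuous fun x => fderiv ℝ f x e :=
    (hf.continuous_fderiv (by simp)).clm_apply continuous_const
  have hs' : HasCompactSupport fun x => fderiv ℝ φ x e :=
    hφ.hasCompactSupport.fderiv_apply (𝕜 := ℝ) e
  have h0 : ∀ x ∉ Ω, φ x = 0 := fun x hx =>
    image_eq_zero_of_notMem_tsupport fun h => hx (hφ.tsupport_subset h)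
  have h1 : ∀ x ∉ Ω, fderiv ℝ φ x = 0 := fun x hx =>
    image_eq_zero_of_notMem_tsupport fun h =>
      hx (hφ.tsupport_subset (tsupport_fderiv_subset ℝ h))
  rw [setIntegral_eq_integral_of_forall_compl_eq_zero fun x hx => by simp [h1 x hx],
    setIntegral_eq_integral_of_forall_compl_eq_zero fun x hx => by simp [h0 x hx]]
  exact integral_mul_fderiv_eq_neg_fderiv_mul_of_integrable
    ((hf'.mul hφ.smooth.continuous).integrable_of_hasCompactSupport
      hφ.hasCompactSupport.mul_left)
    ((hf.continuous.mul hφ').integrable_of_hasCompactSupport hs'.mul_left)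
    ((hf.continuous.mul hφ.smooth.continuous).integrable_of_hasCompactSupport
      hφ.hasCompactSupport.mul_left)
    (fun x _ => hf.differentiable (by simp) x) (fun x _ => hφ.smooth.differentiable (by simp) x)

lemma memLp_of_continuous {F : Type*} [NormedAddCommGroup F] [SecondCountableTopology F]
    (hb : Bornology.IsBounded Ω) (hΩ : MeasurableSet Ω) {f : E n → F} (hf : Continuous f) :
    MemLp f 2 (volume.restrict Ω) := by
  have : IsFiniteMeasure (volume.restrict Ω) := ⟨by simpa using hb.measure_lt_top⟩
  obtain ⟨C, hC⟩ := (hb.isCompact_closure.image hf).isBounded.exists_norm_le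
  refine MemLp.of_bound hf.aestronglyMeasurable C ?_
  filter_upwards [ae_restrict_mem hΩ] with x hx
  exact hC _ (mem_image_of_mem _ (subset_closure hx))

/-- A `C¹` function on the whole space restricts to an element of `H¹(Ω)` for bounded `Ω`. -/
lemma exists_H1_of_contDiff (hb : Bornology.IsBounded Ω) (hΩ : MeasurableSet Ω) {f : E n → ℝ}
    (hf : ContDiff ℝ 1 f) : ∃ u : H1 Ω, fn u =ᵐ[volume.restrict Ω] f ∧
      grad u =ᵐ[volume.restrict Ω] gradient f := by
  have hg : Continuous (gradient f) :=
    (InnerProductSpace.toDual ℝ (E n)).symm.continuous.comp (hf.continuous_fderiv (by simp))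
  have h1 := memLp_of_continuous hb hΩ hf.continuous
  have h2 := memLp_of_continuous hb hΩ hg
  refine ⟨⟨WithLp.toLp 2 (h1.toLp f, h2.toLp _), fun φ hφ e => ?_⟩, h1.coeFn_toLp, h2.coeFn_toLp⟩
  have hl : (fun x => h1.toLp f x * fderiv ℝ φ x e) =ᵐ[volume.restrict Ω]
      fun x => f x * fderiv ℝ φ x e := by
    filter_upwards [h1.coeFn_toLp] with x hx
    rw [hx]
  have hr : (fun x => inner ℝ (h2.toLp _ x) e * φ x) =ᵐ[volume.restrict Ω]
      fun x => fderiv ℝ f x e * φ x := by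
    filter_upwards [h2.coeFn_toLp] with x hx
    rw [hx, inner_gradient_left]
  exact (integral_congr_ae hl).trans
    ((hφ.integral_mul_fderiv hf e).trans (congrArg _ (integral_congr_ae hr).symm))

/-- The harmonic function `e^{s xᵢ} cos (s xⱼ)` (for `i ≠ j`) on the whole space. -/
def expCos (i j : Fin n) (s : ℝ) (x : E n) : ℝ := Real.exp (s * x i) * Real.cos (s * x j)

/-- The harmonic conjugate of `expCos i j s` in the `(xᵢ, xⱼ)` plane. -/
def expSin (i j : Fin n) (s : ℝ) (x : E n) : ℝ := Real.exp (s * x i) * Real.sin (s * x j)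

lemma contDiff_expCos (i j : Fin n) (s : ℝ) {m : WithTop ℕ∞} : ContDiff ℝ m (expCos i j s) := by
  unfold expCos; fun_prop

lemma contDiff_expSin (i j : Fin n) (s : ℝ) {m : WithTop ℕ∞} : ContDiff ℝ m (expSin i j s) := by
  unfold expSin; fun_prop

lemma hasFDerivAt_coord (i : Fin n) (s : ℝ) (x : E n) :
    HasFDerivAt (fun y : E n => s * y i) (s • (EuclideanSpace.proj i : E n →L[ℝ] ℝ)) x :=
  (EuclideanSpace.proj i : E n →L[ℝ] ℝ).hasFDerivAt.const_mul s

lemma fderiv_expCos (i j : Fin n) (s : ℝ) (x e : E n) :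
    fderiv ℝ (expCos i j s) x e = s * (expCos i j s x * e i - expSin i j s x * e j) := by
  have h : HasFDerivAt (expCos i j s) _ x :=
    (hasFDerivAt_coord i s x).exp.mul (hasFDerivAt_coord j s x).cos
  rw [h.fderiv]
  simp [expCos, expSin]
  ring

lemma fderiv_expSin (i j : Fin n) (s : ℝ) (x e : E n) :
    fderiv ℝ (expSin i j s) x e = s * (expSin i j s x * e i + expCos i j s x * e j) := by
  have h : HasFDerivAt (expSin i j s) _ x :=
    (hasFDerivAt_coord i s x).exp.mul (hasFDerivAt_coord j s x).sin
  rw [h.fderiv]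
  simp [expCos, expSin]
  ring

lemma gradient_expCos (i j : Fin n) (s : ℝ) (x : E n) :
    gradient (expCos i j s) x = s • (expCos i j s x • EuclideanSpace.single i 1
      - expSin i j s x • EuclideanSpace.single j 1) := by
  refine ext_inner_right ℝ fun e => ?_
  rw [inner_gradient_left, fderiv_expCos]
  simp [real_inner_smul_left, inner_sub_left, EuclideanSpace.inner_single_left]

lemma norm_gradient_expCos_sq {i j : Fin n} (hij : i ≠ j) (s : ℝ) (x : E n) :
    ‖gradient (expCos i j s) x‖ ^ 2 = s ^ 2 * Real.exp (s * x i) ^ 2 := by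
  rw [← real_inner_self_eq_norm_sq, inner_gradient_left, fderiv_expCos, gradient_expCos]
  simp [hij, hij.symm]
  simp only [expCos, expSin]
  linear_combination s ^ 2 * Real.exp (s * x i) ^ 2 * Real.cos_sq_add_sin_sq (s * x j)

/-- The function `expCos i j s` is harmonic, so its gradient is orthogonal to the gradients of
`H¹₀(Ω)`. -/
lemma inner_gradL_eq_zero {i j : Fin n} (hij : i ≠ j) {s : ℝ} {u z : H1 Ω}
    (hu : grad u =ᵐ[volume.restrict Ω] gradient (expCos i j s)) (hz : z ∈ H10 Ω) :
    inner ℝ (gradL Ω u) (gradL Ω z) = 0 := by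
  refine H10_induction (P := fun z => inner ℝ (gradL Ω u) (gradL Ω z) = 0) ?_ ?_ hz
  · exact isClosed_eq (continuous_const.inner (gradL Ω).continuous) continuous_const
  · clear! z
    intro z φ hφ _ hgrad
    set a : E n := EuclideanSpace.single i 1
    set b : E n := EuclideanSpace.single j 1
    have h1 := hφ.integral_mul_fderiv (contDiff_expCos i j s) a
    have h2 := hφ.integral_mul_fderiv (contDiff_expSin i j s) b
    have hint {f : E n → ℝ} (hf : Continuous f) (e : E n) :
        Integrable (fun x => f x * fderiv ℝ φ x e) (volume.restrict Ω) :=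
      ((hf.mul ((hφ.smooth.continuous_fderiv (by simp)).clm_apply
        continuous_const)).integrable_of_hasCompactSupport
          (hφ.hasCompactSupport.fderiv_apply (𝕜 := ℝ) e).mul_left).restrict
    have h3 : ∀ᵐ x ∂(volume.restrict Ω), inner ℝ (gradL Ω u x) (gradL Ω z x)
        = s * (expCos i j s x * fderiv ℝ φ x a - expSin i j s x * fderiv ℝ φ x b) := by
      filter_upwards [hu, hgrad] with x h4 h5
      rw [coeFn_gradL, coeFn_gradL, h4, h5, real_inner_comm, inner_gradient_left, gradient_expCos]
      simp [a, b]
    -- both integrals equal `-∫ s e^{s xᵢ} cos (s xⱼ) φ`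
    have h4 : ∀ x, fderiv ℝ (expCos i j s) x a = fderiv ℝ (expSin i j s) x b := fun x => by
      simp [fderiv_expCos, fderiv_expSin, a, b, hij, hij.symm]
    rw [L2.inner_def, integral_congr_ae h3, integral_const_mul,
      integral_sub (hint (contDiff_expCos i j s (m := 0)).continuous a)
        (hint (contDiff_expSin i j s (m := 0)).continuous b), h1, h2]
    simp only [h4, sub_self, mul_zero]

/-- The oscillation of `expCos i j s` makes its gradient large compared with the function. -/
lemma mul_norm_fnL_le {i j : Fin n} (hij : i ≠ j) {s : ℝ} (hs : 0 ≤ s) {u : H1 Ω}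
    (hfn : fn u =ᵐ[volume.restrict Ω] expCos i j s)
    (hgrad : grad u =ᵐ[volume.restrict Ω] gradient (expCos i j s)) :
    s * ‖fnL Ω u‖ ≤ ‖gradL Ω u‖ := by
  have h : ‖s • fnL Ω u‖ ≤ 1 * ‖gradL Ω u‖ := by
    refine Lp.norm_le_mul_norm_of_ae_le_mul ?_
    filter_upwards [Lp.coeFn_smul s (fnL Ω u), hfn, hgrad] with x h1 h2 h3
    rw [h1, Pi.smul_apply, coeFn_fnL, coeFn_gradL, h2, h3, one_mul]
    refine le_of_sq_le_sq ?_ (norm_nonneg _)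
    rw [norm_gradient_expCos_sq hij, norm_smul, mul_pow, Real.norm_eq_abs, Real.norm_eq_abs,
      sq_abs, sq_abs, expCos, mul_pow]
    gcongr
    exact mul_le_of_le_one_right (sq_nonneg _) (Real.cos_sq_le_one _)
  rwa [norm_smul, Real.norm_of_nonneg hs, one_mul] at h

lemma norm_gradL_pos {i j : Fin n} (hij : i ≠ j) {s : ℝ} (hs : 0 < s) (hΩ : IsOpen Ω)
    (hne : Ω.Nonempty) {u : H1 Ω}
    (hgrad : grad u =ᵐ[volume.restrict Ω] gradient (expCos i j s)) : 0 < ‖gradL Ω u‖ := by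
  refine norm_pos_iff.2 fun h0 => ?_
  have hz : grad u =ᵐ[volume.restrict Ω] 0 := by
    have := Lp.coeFn_zero (E n) 2 (volume.restrict Ω)
    rw [← h0] at this
    exact this
  have hF : ∀ᵐ x ∂(volume.restrict Ω), False := by
    filter_upwards [hz, hgrad] with x h1 h2
    have h3 := norm_gradient_expCos_sq hij s x
    rw [← h2, h1] at h3
    have : 0 < s ^ 2 * Real.exp (s * x i) ^ 2 := by positivity
    rw [← h3] at this
    simp at this
  have h4 : volume Ω = 0 := by simpa [ae_iff] using hF
  exact (hΩ.measure_pos volume hne).ne' h4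

/-! ### Recovering the leading coefficient -/

lemma norm_sq_le_norm_add_sq {F : Type*} [NormedAddCommGroup F] [InnerProductSpace ℝ F] {a b : F}
    (h : inner ℝ a b = 0) : ‖a‖ ^ 2 ≤ ‖a + b‖ ^ 2 := by
  rw [norm_add_sq_real, h, mul_zero, add_zero]
  exact le_add_of_nonneg_right (sq_nonneg _)

/-- The harmonic function `expCos i j s` has the least Dirichlet energy for its boundary values. -/
lemma norm_gradL_sq_le_of_isWeakSolution {k : ℝ} {c : E n → ℝ} {i j : Fin n} (hij : i ≠ j) {s : ℝ}
    {u v : H1 Ω} (hu : grad u =ᵐ[volume.restrict Ω] gradient (expCos i j s))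
    (hv : IsWeakSolution Ω k c (trace u) v) : ‖gradL Ω u‖ ^ 2 ≤ ‖gradL Ω v‖ ^ 2 := by
  obtain ⟨z, hz, hvz⟩ := hv.exists_eq_add
  have h1 : gradL Ω v = gradL Ω u + gradL Ω z :=
    (congrArg (gradL Ω) hvz).trans (map_add (gradL Ω) u z)
  have h2 := norm_sq_le_norm_add_sq (inner_gradL_eq_zero hij hu hz)
  rwa [← h1] at h2

lemma sub_mul_le_of_le {k₁ k₂ x y a b : ℝ} (hk₂ : 0 ≤ k₂) (h1 : x ≤ y) (h2 : k₂ * y ≤ a)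
    (h3 : a ≤ k₁ * x + b) : (k₂ - k₁) * x ≤ b := by
  nlinarith [mul_le_mul_of_nonneg_left h1 hk₂]

/-- The Dirichlet-to-Neumann map is defined on all traces. -/
lemma exists_mem_dtn (hΩ : IsOpen Ω) (hb : Bornology.IsBounded Ω) (i : Fin n) {k : ℝ} (hk : 0 < k)
    {c : E n → ℝ} {M : ℝ} (hc : AEMeasurable c (volume.restrict Ω))
    (hM : ∀ᵐ x ∂(volume.restrict Ω), 0 ≤ c x ∧ c x ≤ M) (u : H1 Ω) :
    ∃ ψ, (trace u, ψ) ∈ dtn Ω k c := by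
  obtain ⟨R, hR0, hR⟩ := hb.exists_pos_norm_le
  obtain ⟨v, hv⟩ := exists_isWeakSolution hk hc hM
    (fun z hz => norm_fnL_le_of_mem_H10 i hR0.le hR hΩ hz) u
  obtain ⟨ψ, hψ⟩ := hv.exists_isConormal hc hM
  exact ⟨ψ, v, hv, hψ⟩

/-- If a trace `u|_∂Ω` of a function `u` with the gradient of `expCos i j s` has the same
co-normal derivative for both equations, then the energy identity for the second solution and
Dirichlet's principle for the first bound `(k₂ - k₁) ‖∇u‖²` by a multiple of `‖u‖²`. -/
lemma sub_mul_norm_gradL_sq_le {k₁ k₂ M₁ M₂ : ℝ} (hk₁ : 0 < k₁) (hk₂ : 0 < k₂) {c₁ c₂ : E n → ℝ}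
    (hc₁ : AEMeasurable c₁ (volume.restrict Ω))
    (hM₁ : ∀ᵐ x ∂(volume.restrict Ω), 0 ≤ c₁ x ∧ c₁ x ≤ M₁)
    (hc₂ : AEMeasurable c₂ (volume.restrict Ω))
    (hM₂ : ∀ᵐ x ∂(volume.restrict Ω), 0 ≤ c₂ x ∧ c₂ x ≤ M₂)
    {i j : Fin n} (hij : i ≠ j) {s : ℝ} {u : H1 Ω} {ψ : HNegHalf Ω}
    (hu : grad u =ᵐ[volume.restrict Ω] gradient (expCos i j s))
    (h₁ : (trace u, ψ) ∈ dtn Ω k₁ c₁) (h₂ : (trace u, ψ) ∈ dtn Ω k₂ c₂) :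
    (k₂ - k₁) * ‖gradL Ω u‖ ^ 2 ≤ M₁ * ‖fnL Ω u‖ ^ 2 := by
  obtain ⟨v₁, hv₁, hψ₁⟩ := h₁
  obtain ⟨v₂, hv₂, hψ₂⟩ := h₂
  have h1 : form Ω k₂ c₂ v₂ v₂ = form Ω k₁ c₁ v₁ v₁ :=
    (hψ₂.apply_trace_eq hv₂).symm.trans (hψ₁.apply_trace_eq hv₁)
  have h2 := (hv₁.form_self_le hk₁.le hc₁ hM₁).trans (form_self_le k₁ hc₁ hM₁ u)
  exact sub_mul_le_of_le hk₂.le (norm_gradL_sq_le_of_isWeakSolution hij hu hv₂)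
    (le_form_self k₂ hc₂ hM₂ v₂) (h1.trans_le h2)

/-- One inequality between the leading coefficients; it holds on every nonempty bounded open set
in dimension at least two. -/
theorem le_of_dtn_eq (hΩ : IsOpen Ω) (hne : Ω.Nonempty) (hb : Bornology.IsBounded Ω)
    {i j : Fin n} (hij : i ≠ j)
    {k₁ k₂ M₁ M₂ : ℝ} (hk₁ : 0 < k₁) (hk₂ : 0 < k₂) {c₁ c₂ : E n → ℝ}
    (hc₁ : AEMeasurable c₁ (volume.restrict Ω))
    (hM₁ : ∀ᵐ x ∂(volume.restrict Ω), 0 ≤ c₁ x ∧ c₁ x ≤ M₁)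
    (hc₂ : AEMeasurable c₂ (volume.restrict Ω))
    (hM₂ : ∀ᵐ x ∂(volume.restrict Ω), 0 ≤ c₂ x ∧ c₂ x ≤ M₂)
    (hΛ : dtn Ω k₁ c₁ = dtn Ω k₂ c₂) : k₂ ≤ k₁ := by
  by_contra! hlt
  have hd : 0 < k₂ - k₁ := sub_pos.2 hlt
  -- a frequency `s` with `M₁ < (k₂ - k₁) s²`
  obtain ⟨s, hs0, hs⟩ : ∃ s : ℝ, 0 < s ∧ M₁ < (k₂ - k₁) * s ^ 2 := by
    refine ⟨max 1 (M₁ / (k₂ - k₁) + 1), lt_max_of_lt_left one_pos, ?_⟩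
    set s := max 1 (M₁ / (k₂ - k₁) + 1)
    have h1 : 1 ≤ s := le_max_left _ _
    have h2 : M₁ / (k₂ - k₁) < s := (lt_add_one _).trans_le (le_max_right _ _)
    rw [div_lt_iff₀ hd, mul_comm] at h2
    exact h2.trans_le (mul_le_mul_of_nonneg_left (by nlinarith) hd.le)
  obtain ⟨u, hfn, hgrad⟩ := exists_H1_of_contDiff hb hΩ.measurableSet
    (contDiff_expCos i j s (m := 1))
  obtain ⟨ψ, hψ⟩ := exists_mem_dtn hΩ hb i hk₂ hc₂ hM₂ u
  have h1 := sub_mul_norm_gradL_sq_le hk₁ hk₂ hc₁ hM₁ hc₂ hM₂ hij hgrad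
    ((Set.ext_iff.1 hΛ _).2 hψ) hψ
  have h2 := mul_norm_fnL_le hij hs0.le hfn hgrad
  have h3 := norm_gradL_pos hij hs0 hΩ hne hgrad
  have h4 := norm_nonneg (fnL Ω u)
  generalize ‖fnL Ω u‖ = x at h1 h2 h4
  generalize ‖gradL Ω u‖ = y at h1 h2 h3
  have h5 : (s * x) ^ 2 ≤ y ^ 2 := pow_le_pow_left₀ (by positivity) h2 2
  have h6 : (k₂ - k₁) * s ^ 2 * x ^ 2 ≤ M₁ * x ^ 2 := by
    refine le_trans ?_ h1
    rw [mul_assoc, ← mul_pow]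
    gcongr
  have h7 : x ^ 2 = 0 := by
    by_contra h
    exact hs.not_ge (le_of_mul_le_mul_right h6 (lt_of_le_of_ne (sq_nonneg x) (Ne.symm h)))
  rw [h7, mul_zero] at h1
  exact h1.not_gt (by positivity)

end LinDtN
end

theorem theorem3 {n : ℕ} (hn : n = 2 ∨ n = 3) (Ω : Set (LinDtN.E n))
    (hΩ : LinDtN.IsPiecewiseC1Domain Ω)
    (a₁ a₂ : ℝ → ℝ) (c₁ c₂ : LinDtN.E n → ℝ)
    (h₁ : LinDtN.Admissible Ω a₁ c₁) (h₂ : LinDtN.Admissible Ω a₂ c₂)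
    (hΛ : LinDtN.dtn Ω (a₁ 0) c₁ = LinDtN.dtn Ω (a₂ 0) c₂) :
    a₁ 0 = a₂ 0 := by
  obtain ⟨α₁, hα₁, ha₁, hM₁⟩ := h₁.bounds
  obtain ⟨α₂, hα₂, ha₂, hM₂⟩ := h₂.bounds
  have hk₁ : 0 < a₁ 0 := hα₁.trans_le (ha₁ 0).1
  have hk₂ : 0 < a₂ 0 := hα₂.trans_le (ha₂ 0).1
  have hn2 : 2 ≤ n := by omega
  have hij : (⟨0, by omega⟩ : Fin n) ≠ ⟨1, by omega⟩ := by simp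
  exact le_antisymm
    (LinDtN.le_of_dtn_eq hΩ.isOpen hΩ.isConnected.nonempty hΩ.isBounded hij hk₂ hk₁
      h₂.aemeasurable hM₂ h₁.aemeasurable hM₁ hΛ.symm)
    (LinDtN.le_of_dtn_eq hΩ.isOpen hΩ.isConnected.nonempty hΩ.isBounded hij hk₁ hk₂
      h₁.aemeasurable hM₁ h₂.aemeasurable hM₂ hΛ)
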